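/- Let $G=(X,\omega)$ be a finite network: $X$ is a finite set and $\omega\colon X\times X\to[0,\infty]$. Let $P(G)=(X,d)$ be its path completion, where $d(x,y)$ is the infimum of the total weights of the finite paths from $x$ to $y$ (the constant path from $x$ to $x$ has weight $0$). For $0\le\delta<\infty$ let $\mathfrak D^\star_\delta(G)$ be the simplicial complex whose simplices are the nonempty sets $\sigma\subseteq X$ for which there is $y\in X$ with $\omega(y,x)\le\delta$ for all $x\in\sigma$, and let $\mathfrak D_\delta(G)=\mathfrak D^\star_\delta(P(G))$ be the Dowker source complex of $G$. The maximal Dowker complex of $G$ is $\mathfrak D_{\delta_{\max}}(G)$ for any finite $\delta_{\max}>0$ such that $\mathfrak D_\delta(G)=\mathfrak D_{\delta_{\max}}(G)$ for all finite $\delta>\delta_{\max}$; the maximal non path completed complex $\mathfrak D^\star_{\delta_{\max}}(G)$ is defined in the same way. A source dominating set of $G$ is a set $K\subseteq X$ such that for every $x\in X$ there is $v\in K$ with $\omega(v,x)<\infty$; it is minimal if no strict subset of it is source dominating. Let $k\ge 1$ and let $K\subseteq X$ be a set with $|K|\le k$. Reduced simplicial homology is taken with coefficients in an arbitrary commutative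 ring (in particular $\mathbb R$). 1. If $K$ is a minimal source dominating set of $G$ or of $P(G)$, then the maximal Dowker complex of $G$ has trivial reduced homology in every degree $n\ge k-1$. 2. If $K$ is a minimal source dominating set of $G$, and the finite weights of $G$ are transitive ($\omega(x,y)<\infty$ and $\omega(y,z)<\infty$ imply $\omega(x,z)<\infty$), then the maximal non path completed complex $\mathfrak D^\star_{\delta_{\max}}(G)$ also has trivial reduced homology in every degree $n\ge k-1$. -/

import Mathlib

open scoped NNReal ENNReal

/-- A network (weighted digraph) on the vertex set `X`: a weight in `[0, ∞]` for every ordered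
pair of vertices, where the weight `∞` means that there is no edge. -/
structure Network (X : Type*) where
  weight : X → X → ℝ≥0∞

/-! ### Simplicial homology -/

/-- The quotient `Z / B` of a submodule `Z` by a submodule `B` (in the uses below `B ≤ Z`). -/
abbrev Subquotient {R M : Type*} [Ring R] [AddCommGroup M] [Module R M] (Z B : Submodule R M) :
    Type _ :=
  Z ⧸ B.submoduleOf Z

/-- The boundary operator on formal combinations of finite subsets of a linearly ordered vertex
set: `∂[v₀ < ⋯ < vₙ] = ∑ i, (-1) ^ i • [v₀, …, vᵢ omitted, …, vₙ]`. The position `i` of a vertex `x`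
of `s` is the number of vertices of `s` below `x`. The empty set is the generator in degree `-1`,
so on single vertices this is the augmentation `∂[v] = [∅]`. -/
noncomputable def simplicialBoundary (R : Type*) [CommRing R] (X : Type*) [LinearOrder X] :
    (Finset X →₀ R) →ₗ[R] (Finset X →₀ R) :=
  Finsupp.linearCombination R fun s : Finset X =>
    ∑ x ∈ s, Finsupp.single (s.erase x) ((-1 : R) ^ (s.filter (· < x)).card)

theorem simplicialBoundary_single (R : Type*) [CommRing R] {X : Type*} [LinearOrder X]
    (s : Finset X) :
    simplicialBoundary R X (Finsupp.single s 1) =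
      ∑ x ∈ s, Finsupp.single (s.erase x) ((-1 : R) ^ (s.filter (· < x)).card) := by
  simp [simplicialBoundary]

theorem simplicialBoundary_comp_self (R : Type*) [CommRing R] (X : Type*) [LinearOrder X] :
    simplicialBoundary R X ∘ₗ simplicialBoundary R X = 0 := by
  apply Finsupp.lhom_ext'
  intro s
  apply LinearMap.ext_ring
  have h1 : ∀ (t : Finset X) (c : R), simplicialBoundary R X (Finsupp.single t c) =
      ∑ y ∈ t, Finsupp.single (t.erase y) (c * (-1 : R) ^ (t.filter (· < y)).card) := by
    intro t c
    simp [simplicialBoundary, Finset.smul_sum]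
  simp only [LinearMap.comp_apply, Finsupp.lsingle_apply, LinearMap.zero_apply, h1, map_sum,
    one_mul]
  rw [Finset.sum_sigma']
  refine Finset.sum_involution (fun p _ => ⟨p.2, p.1⟩) ?_ ?_ ?_ ?_
  · rintro ⟨x, y⟩ hp
    simp only [Finset.mem_sigma, Finset.mem_erase] at hp
    obtain ⟨hx, hyx, hy⟩ := hp
    have key : ∀ a b : X, a ∈ s → b ∈ s → a < b →
        (-1 : R) ^ (s.filter (· < a)).card * (-1 : R) ^ ((s.erase a).filter (· < b)).card +
        (-1 : R) ^ (s.filter (· < b)).card * (-1 : R) ^ ((s.erase b).filter (· < a)).card = 0 := by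
      intro a b ha hb hab
      have e1 : (s.erase b).filter (· < a) = s.filter (· < a) := by
        ext z
        simp only [Finset.mem_filter, Finset.mem_erase]
        constructor
        · rintro ⟨⟨_, h⟩, h'⟩
          exact ⟨h, h'⟩
        · rintro ⟨h, h'⟩
          exact ⟨⟨(h'.trans hab).ne, h⟩, h'⟩
      have e2 : (s.filter (· < b)).card = ((s.erase a).filter (· < b)).card + 1 := by
        rw [Finset.filter_erase, Finset.card_erase_add_one]
        simp [ha, hab]
      rw [e1, e2, pow_succ]
      ring
    rw [Finset.erase_right_comm (a := y) (b := x), ← Finsupp.single_add]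
    rcases lt_or_gt_of_ne hyx with h | h
    · rw [add_comm, key y x hy hx h, Finsupp.single_zero]
    · rw [key x y hx hy h, Finsupp.single_zero]
  · rintro ⟨x, y⟩ hp _ heq
    simp only [Finset.mem_sigma, Finset.mem_erase] at hp
    simp only [Sigma.mk.injEq] at heq
    exact hp.2.1 heq.1
  · rintro ⟨x, y⟩ hp
    simp only [Finset.mem_sigma, Finset.mem_erase] at hp ⊢
    exact ⟨hp.2.2, fun h => hp.2.1 h.symm, hp.1⟩
  · rintro ⟨x, y⟩ _
    rfl

namespace PreAbstractSimplicialComplex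

variable {X : Type*}

/-- The augmented chains of `D` on `m` vertices, that is in degree `m - 1`: formal combinations of
the faces with exactly `m` vertices, and of the empty set if `m = 0`. -/
noncomputable def augChains (R : Type*) [CommRing R] (D : PreAbstractSimplicialComplex X) (m : ℕ) :
    Submodule R (Finset X →₀ R) :=
  Finsupp.supported R R {s : Finset X | s.card = m ∧ (s = ∅ ∨ s ∈ D.faces)}

/-- The reduced `n`-cycles of `D`. -/
noncomputable def reducedCycles (R : Type*) [CommRing R] [LinearOrder X]
    (D : PreAbstractSimplicialComplex X) (n : ℕ) : Submodule R (Finset X →₀ R) :=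
  D.augChains R (n + 1) ⊓ LinearMap.ker (simplicialBoundary R X)

/-- The `n`-boundaries of `D`. -/
noncomputable def boundaries (R : Type*) [CommRing R] [LinearOrder X]
    (D : PreAbstractSimplicialComplex X) (n : ℕ) : Submodule R (Finset X →₀ R) :=
  (D.augChains R (n + 2)).map (simplicialBoundary R X)

theorem boundaries_le_reducedCycles (R : Type*) [CommRing R] [LinearOrder X]
    (D : PreAbstractSimplicialComplex X) (n : ℕ) :
    D.boundaries R n ≤ D.reducedCycles R n := by
  refine le_inf ?_ ?_
  · rw [boundaries, augChains, Finsupp.supported_eq_span_single, Submodule.map_span_le]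
    rintro _ ⟨s, ⟨hc, hs⟩, rfl⟩
    rw [simplicialBoundary_single]
    refine Submodule.sum_mem _ fun x hx => Finsupp.single_mem_supported R _ ?_
    have hcard : (s.erase x).card = n + 1 := by
      rw [Finset.card_erase_of_mem hx, hc]
      rfl
    have hne : (s.erase x).Nonempty := Finset.card_pos.mp (by omega)
    refine ⟨hcard, Or.inr ?_⟩
    rcases hs with rfl | hs
    · simp at hx
    · exact (D.isRelLowerSet_faces hs).2 (Finset.erase_subset x s) hne
  · rintro _ ⟨c, _, rfl⟩
    exact LinearMap.congr_fun (simplicialBoundary_comp_self R X) c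

/-- The reduced simplicial homology of `D` in degree `n ≥ 0` with coefficients in `R`:
cycles modulo boundaries. -/
abbrev ReducedHomology (R : Type*) [CommRing R] [LinearOrder X]
    (D : PreAbstractSimplicialComplex X) (n : ℕ) : Type _ :=
  Subquotient (D.reducedCycles R n) (D.boundaries R n)

end PreAbstractSimplicialComplex

/-! ### Dowker complexes -/

/-- The Dowker source complex of a relation `r`: its simplices are the nonempty finite sets `σ` of
targets which have a common source, that is `r y x` for all `x ∈ σ`, for some `y`. -/
def dowkerSourceComplex {Y X : Type*} (r : Y → X → Prop) : PreAbstractSimplicialComplex X where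
  faces := {σ | σ.Nonempty ∧ ∃ y, ∀ x ∈ σ, r y x}
  isRelLowerSet_faces := by
    rintro σ ⟨hσ, y, hy⟩
    exact ⟨hσ, fun τ hτ hne => ⟨hne, y, fun x hx => hy x (hτ hx)⟩⟩

namespace Network

variable {X : Type*}

/-- The relation `R_δ(G)`. -/
def rel (G : Network X) (δ : ℝ≥0) (x y : X) : Prop := G.weight x y ≤ δ

/-- The weight of the path that starts at `x` and then visits the vertices of the list in order. -/
noncomputable def pathWeight (G : Network X) : X → List X → ℝ≥0∞
  | _, [] => 0
  | x, y :: l => G.weight x y + G.pathWeight y l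

/-- The path completion `P(G)`: its weight is the shortest path function of `G`, the infimum of the
weights of all finite paths from `x` to `y`, including the constant path if `x = y`. -/
noncomputable def pathCompletion (G : Network X) : Network X where
  weight x y := ⨅ (l : List X) (_ : (x :: l).getLast (List.cons_ne_nil x l) = y), G.pathWeight x l

/-- The Dowker source complex at scale `δ` without path completion, `𝔇⋆_δ(G)`. -/
def dowkerStar (G : Network X) (δ : ℝ≥0) : PreAbstractSimplicialComplex X :=
  dowkerSourceComplex (G.rel δ)

/-- The Dowker source filtration, `𝔇_δ(G) = 𝔇⋆_δ(P(G))`. -/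
noncomputable def dowker (G : Network X) (δ : ℝ≥0) : PreAbstractSimplicialComplex X :=
  G.pathCompletion.dowkerStar δ

/-- `K` is a source dominating set of `G`. -/
def IsSourceDominating (G : Network X) (K : Finset X) : Prop :=
  ∀ x : X, ∃ v ∈ K, G.weight v x < ∞

/-- `K` is a minimal source dominating set of `G`: no strict subset is source dominating. -/
def IsMinimalSourceDominating (G : Network X) (K : Finset X) : Prop :=
  G.IsSourceDominating K ∧ ∀ K' : Finset X, K' ⊂ K → ¬ G.IsSourceDominating K'

end Network

/-- `D` is the maximal complex of the filtration `F`: the complex `F δ_max` at some `δ_max > 0`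
such that `F δ = F δ_max` for all finite `δ > δ_max`. -/
def IsMaximalComplex {X : Type*} (F : ℝ≥0 → PreAbstractSimplicialComplex X)
    (D : PreAbstractSimplicialComplex X) : Prop :=
  ∃ δmax : ℝ≥0, 0 < δmax ∧ D = F δmax ∧ ∀ δ : ℝ≥0, δmax < δ → F δ = F δmax

theorem IsMaximalComplex.unique {X : Type*} {F : ℝ≥0 → PreAbstractSimplicialComplex X}
    {D D' : PreAbstractSimplicialComplex X} (h : IsMaximalComplex F D)
    (h' : IsMaximalComplex F D') : D = D' := by
  obtain ⟨a, _, rfl, ha⟩ := h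
  obtain ⟨b, _, rfl, hb⟩ := h'
  rcases lt_trichotomy a b with hab | rfl | hab
  · exact (ha b hab).symm
  · rfl
  · exact hb a hab

/-- Every finite network has a maximal complex (apply this to `P(G)` for the path completed one). -/
theorem Network.exists_isMaximalComplex {X : Type*} [Finite X] (G : Network X) :
    ∃ D, IsMaximalComplex G.dowkerStar D := by
  have := Fintype.ofFinite X
  let δ₀ : ℝ≥0 := (∑ x : X, ∑ y : X, (G.weight x y).toNNReal) + 1
  have hbound : ∀ (δ : ℝ≥0) (x y : X), G.weight x y ≤ δ → G.weight x y ≤ δ₀ := by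
    intro δ x y h
    have hfin : G.weight x y ≠ ∞ := ne_top_of_le_ne_top ENNReal.coe_ne_top h
    rw [← ENNReal.coe_toNNReal hfin, ENNReal.coe_le_coe]
    have h1 : (G.weight x y).toNNReal ≤ ∑ y : X, (G.weight x y).toNNReal :=
      Finset.single_le_sum (f := fun y => (G.weight x y).toNNReal)
        (fun _ _ => zero_le) (Finset.mem_univ y)
    have h2 : ∑ y : X, (G.weight x y).toNNReal ≤ ∑ x : X, ∑ y : X, (G.weight x y).toNNReal :=
      Finset.single_le_sum (f := fun x => ∑ y : X, (G.weight x y).toNNReal)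
        (fun _ _ => zero_le) (Finset.mem_univ x)
    exact (h1.trans h2).trans le_self_add
  refine ⟨_, δ₀, by positivity, rfl, fun δ hδ => ?_⟩
  refine PreAbstractSimplicialComplex.ext (Set.ext fun σ => ?_)
  constructor
  · rintro ⟨hσ, y, hy⟩
    exact ⟨hσ, y, fun x hx => hbound δ y x (hy x hx)⟩
  · rintro ⟨hσ, y, hy⟩
    exact ⟨hσ, y, fun x hx => (hy x hx).trans (ENNReal.coe_le_coe.mpr hδ.le)⟩

/-! At a large finite scale, a nonempty set is a simplex exactly when some `y` has finite weight to
all its members. If finiteness of weights is transitive, as it always is in the path completion, any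
`v ∈ K` dominating `y` has finite weight to all these members too. The maximal complex is therefore
the union, over `v ∈ K`, of the full simplices on `{x | G.weight v x < ∞}`. A union of `k` full
simplices has no reduced homology in degrees `≥ k - 1`: intersections of full simplices are full
simplices, possibly empty, so Mayer–Vietoris and induction on `k` apply, each added simplex costing
one degree (`SimplicialExactAt.union`, `simplicialExactAt_iUnion_simplex`). Degrees are counted by
numbers of vertices, so degree `n` appears as `m = n + 1`. -/

section Exactness

variable {X : Type*} [LinearOrder X] (R : Type*) [CommRing R]

/-- Every cycle on the `m`-element members of `S` bounds a chain on the `(m + 1)`-element members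
of `S`. -/
def SimplicialExactAt (S : Set (Finset X)) (m : ℕ) : Prop :=
  ∀ z ∈ Finsupp.supported R R {s : Finset X | s.card = m ∧ s ∈ S}, simplicialBoundary R X z = 0 →
    ∃ w ∈ Finsupp.supported R R {s : Finset X | s.card = m + 1 ∧ s ∈ S},
      simplicialBoundary R X w = z

variable {R}

theorem simplicialBoundary_mem_supported {S : Set (Finset X)} (hS : IsLowerSet S) {m : ℕ}
    {z : Finset X →₀ R}
    (hz : z ∈ Finsupp.supported R R {s : Finset X | s.card = m + 1 ∧ s ∈ S}) :
    simplicialBoundary R X z ∈ Finsupp.supported R R {s : Finset X | s.card = m ∧ s ∈ S} := by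
  have h : (Finsupp.supported R R {s : Finset X | s.card = m + 1 ∧ s ∈ S}).map
      (simplicialBoundary R X) ≤ Finsupp.supported R R {s : Finset X | s.card = m ∧ s ∈ S} := by
    rw [Finsupp.supported_eq_span_single, Submodule.map_span_le]
    rintro _ ⟨s, ⟨hc, hs⟩, rfl⟩
    rw [simplicialBoundary_single]
    refine Submodule.sum_mem _ fun x hx => Finsupp.single_mem_supported R _ ⟨?_, ?_⟩
    · rw [Finset.card_erase_of_mem hx, hc, Nat.add_sub_cancel]
    · exact hS (Finset.erase_subset x s) hs
  exact h (Submodule.mem_map_of_mem hz)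

/-! ### Cones and full simplices -/

variable (R) in
/-- The cone operator with apex `v`. -/
noncomputable def simplicialCone (v : X) : (Finset X →₀ R) →ₗ[R] (Finset X →₀ R) :=
  Finsupp.linearCombination R fun s : Finset X =>
    if v ∈ s then 0 else Finsupp.single (insert v s) 1

theorem simplicialCone_single (v : X) (s : Finset X) (c : R) :
    simplicialCone R v (Finsupp.single s c) =
      if v ∈ s then 0 else Finsupp.single (insert v s) c := by
  by_cases h : v ∈ s <;> simp [simplicialCone, h]

/-- The cone operator is a contracting homotopy on faces that lie above its apex. -/
theorem simplicialBoundary_cone_add_cone_boundary_single {v : X} {s : Finset X}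
    (hs : ∀ x ∈ s, v ≤ x) :
    simplicialBoundary R X (simplicialCone R v (Finsupp.single s 1)) +
      simplicialCone R v (simplicialBoundary R X (Finsupp.single s 1)) = Finsupp.single s 1 := by
  rw [simplicialCone_single, simplicialBoundary_single, map_sum]
  simp only [simplicialCone_single]
  by_cases hv : v ∈ s
  · have h0 : s.filter (· < v) = ∅ :=
      Finset.filter_eq_empty_iff.mpr fun {x} hx => not_lt.mpr (hs x hx)
    rw [if_pos hv, map_zero, zero_add, Finset.sum_eq_single v]
    · rw [if_neg (Finset.notMem_erase v s), Finset.insert_erase hv, h0]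
      simp
    · intro x _ hxv
      rw [if_pos (Finset.mem_erase.mpr ⟨hxv.symm, hv⟩)]
    · exact fun h => absurd hv h
  · have hlt : ∀ x ∈ s, v < x := fun x hx => lt_of_le_of_ne (hs x hx) fun h => hv (h ▸ hx)
    have h0 : (insert v s).filter (· < v) = ∅ := by
      refine Finset.filter_eq_empty_iff.mpr fun {x} hx => not_lt.mpr ?_
      rcases Finset.mem_insert.mp hx with rfl | hx
      · exact le_rfl
      · exact hs x hx
    rw [if_neg hv, simplicialBoundary_single, Finset.sum_insert hv, Finset.erase_insert hv, h0,
      add_assoc, ← Finset.sum_add_distrib, Finset.sum_eq_zero]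
    · simp
    · intro x hx
      have hvx : v ∉ s.erase x := fun h => hv (Finset.mem_of_mem_erase h)
      -- The apex precedes `x`, so its insertion shifts the position of `x` by one; the opposite
      -- sign cancels the two sums.
      have hcard : ((insert v s).filter (· < x)).card = (s.filter (· < x)).card + 1 := by
        rw [Finset.filter_insert, if_pos (hlt x hx), Finset.card_insert_of_notMem (by simp [hv])]
      rw [if_neg hvx, Finset.erase_insert_of_ne (hlt x hx).ne, hcard, ← Finsupp.single_add,
        pow_succ]
      simp

/-- A full simplex is exact in every nonnegative degree. -/
theorem simplicialExactAt_simplex [Finite X] (N : Set X) {m : ℕ} (hm : 1 ≤ m) :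
    SimplicialExactAt R {s : Finset X | (s : Set X) ⊆ N} m := by
  intro z hz hz0
  rcases N.eq_empty_or_nonempty with rfl | hN
  -- The only face is `∅`, whose class survives at `m = 0`; hence the bound `1 ≤ m`.
  · refine ⟨0, Submodule.zero_mem _, ?_⟩
    have h : {s : Finset X | s.card = m ∧ s ∈ {s : Finset X | (s : Set X) ⊆ ∅}} = ∅ := by
      ext s
      simp only [Set.mem_ofPred_eq, Set.subset_empty_iff, Finset.coe_eq_empty,
        Set.mem_empty_iff_false, iff_false, not_and]
      rintro h rfl
      simp at h
      omega
    rw [h, Finsupp.supported_empty, Submodule.mem_bot] at hz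
    rw [hz, map_zero]
  -- Taking the least vertex as apex puts it first in every face, so coning needs no sign.
  · obtain ⟨v, hvN, hv⟩ := Set.exists_min_image N id N.toFinite hN
    have key : ∀ c ∈ Finsupp.supported R R {s : Finset X | s.card = m ∧ (s : Set X) ⊆ N},
        simplicialCone R v c ∈
            Finsupp.supported R R {s : Finset X | s.card = m + 1 ∧ (s : Set X) ⊆ N} ∧
          simplicialBoundary R X (simplicialCone R v c) +
            simplicialCone R v (simplicialBoundary R X c) = c := by
      intro c hc
      rw [Finsupp.supported_eq_span_single] at hc
      induction hc using Submodule.span_induction with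
      | mem c hc =>
        obtain ⟨s, ⟨hcard, hs⟩, rfl⟩ := hc
        refine ⟨?_, simplicialBoundary_cone_add_cone_boundary_single fun x hx => hv x (hs hx)⟩
        rw [simplicialCone_single]
        split_ifs with h
        · exact Submodule.zero_mem _
        · refine Finsupp.single_mem_supported R _ ⟨?_, ?_⟩
          · rw [Finset.card_insert_of_notMem h, hcard]
          · rw [Finset.coe_insert]
            exact Set.insert_subset hvN hs
      | zero => simp
      | add a b _ _ ha hb =>
        simp only [map_add]
        refine ⟨Submodule.add_mem _ ha.1 hb.1, ?_⟩
        nth_rewrite 3 [← ha.2]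
        nth_rewrite 3 [← hb.2]
        abel
      | smul r a _ ha =>
        simp only [map_smul, ← smul_add]
        exact ⟨Submodule.smul_mem _ r ha.1, by rw [ha.2]⟩
    obtain ⟨h1, h2⟩ := key z hz
    exact ⟨_, h1, by rwa [hz0, map_zero, add_zero] at h2⟩

/-! ### Unions of simplices -/

/-- The Mayer–Vietoris argument: exactness of `A`, `B` and `A ∩ B` yields exactness of `A ∪ B`. -/
theorem SimplicialExactAt.union {A B : Set (Finset X)} (hA : IsLowerSet A) (hB : IsLowerSet B)
    {m : ℕ} (eA : SimplicialExactAt R A (m + 1)) (eB : SimplicialExactAt R B (m + 1))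
    (eAB : SimplicialExactAt R (A ∩ B) m) : SimplicialExactAt R (A ∪ B) (m + 1) := by
  intro z hz hz0
  have hU : {s : Finset X | s.card = m + 1 ∧ s ∈ A ∪ B} =
      {s | s.card = m + 1 ∧ s ∈ A} ∪ {s | s.card = m + 1 ∧ s ∈ B} := by
    ext s
    simp only [Set.mem_ofPred_eq, Set.mem_union]
    tauto
  rw [hU, Finsupp.supported_union, Submodule.mem_sup] at hz
  obtain ⟨a, ha, b, hb, rfl⟩ := hz
  rw [map_add] at hz0
  have hda : simplicialBoundary R X a = -simplicialBoundary R X b := eq_neg_of_add_eq_zero_left hz0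
  have hI : {s : Finset X | s.card = m ∧ s ∈ A ∩ B} =
      {s | s.card = m ∧ s ∈ A} ∩ {s | s.card = m ∧ s ∈ B} := by
    ext s
    simp only [Set.mem_ofPred_eq, Set.mem_inter_iff]
    tauto
  -- The connecting map: `∂a = -∂b` is supported on both `A` and `B`.
  have hc : simplicialBoundary R X a ∈
      Finsupp.supported R R {s : Finset X | s.card = m ∧ s ∈ A ∩ B} := by
    rw [hI, Finsupp.supported_inter]
    refine ⟨simplicialBoundary_mem_supported hA ha, ?_⟩
    rw [hda]
    exact Submodule.neg_mem _ (simplicialBoundary_mem_supported hB hb)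
  obtain ⟨e, he, hde⟩ := eAB _ hc (LinearMap.congr_fun (simplicialBoundary_comp_self R X) a)
  have hmono : ∀ {S T : Set (Finset X)}, S ⊆ T → ∀ {l : ℕ} {c : Finset X →₀ R},
      c ∈ Finsupp.supported R R {s : Finset X | s.card = l ∧ s ∈ S} →
        c ∈ Finsupp.supported R R {s : Finset X | s.card = l ∧ s ∈ T} := by
    intro S T hST l c h
    exact Finsupp.supported_mono (Set.ofPred_subset_ofPred.mpr fun s hs => ⟨hs.1, hST hs.2⟩) h
  have heA := hmono Set.inter_subset_left he
  have heB := hmono Set.inter_subset_right he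
  -- Moving `e` from one summand to the other turns both into cycles without changing their sum.
  obtain ⟨u, hu, hdu⟩ := eA (a - e) (Submodule.sub_mem _ ha heA) (by rw [map_sub, hde, sub_self])
  obtain ⟨w, hw, hdw⟩ := eB (b + e) (Submodule.add_mem _ hb heB)
    (by rw [map_add, hde, add_comm, hz0])
  refine ⟨u + w, Submodule.add_mem _ (hmono Set.subset_union_left hu)
    (hmono Set.subset_union_right hw), ?_⟩
  rw [map_add, hdu, hdw]
  abel

/-- A union of `k` full simplices is exact on faces with at least `k` vertices. -/
theorem simplicialExactAt_iUnion_simplex [Finite X] {ι : Type*} (I : Finset ι) (N : ι → Set X)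
    {m : ℕ} (hm : I.card ≤ m) :
    SimplicialExactAt R {s : Finset X | ∃ i ∈ I, (s : Set X) ⊆ N i} m := by
  classical
  -- `N` must vary because the intersection with the new simplex is the family `N i ∩ N j`, needed
  -- one degree lower.
  induction I using Finset.induction_on generalizing N m with
  | empty =>
    intro z hz _
    refine ⟨0, Submodule.zero_mem _, ?_⟩
    have h : z = 0 := by simpa using hz
    rw [h, map_zero]
  | insert j I hj ih =>
    rw [Finset.card_insert_of_notMem hj] at hm
    obtain ⟨m, rfl⟩ : ∃ l, m = l + 1 := ⟨m - 1, by omega⟩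
    have hlow : ∀ S : Set X, IsLowerSet {s : Finset X | (s : Set X) ⊆ S} :=
      fun S s t hts hs => (Finset.coe_subset.mpr hts).trans hs
    have hU : {s : Finset X | ∃ i ∈ insert j I, (s : Set X) ⊆ N i} =
        {s : Finset X | ∃ i ∈ I, (s : Set X) ⊆ N i} ∪ {s | (s : Set X) ⊆ N j} := by
      ext s
      simp [or_comm]
    have hI : {s : Finset X | ∃ i ∈ I, (s : Set X) ⊆ N i} ∩ {s | (s : Set X) ⊆ N j} =
        {s : Finset X | ∃ i ∈ I, (s : Set X) ⊆ N i ∩ N j} := by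
      ext s
      simp only [Set.mem_inter_iff, Set.mem_ofPred_eq, Set.subset_inter_iff]
      constructor
      · rintro ⟨⟨i, hi, h⟩, h'⟩
        exact ⟨i, hi, h, h'⟩
      · rintro ⟨i, hi, h, h'⟩
        exact ⟨⟨i, hi, h⟩, h'⟩
    rw [hU]
    refine SimplicialExactAt.union ?_ (hlow _) (ih N (by omega))
      (simplicialExactAt_simplex _ (by omega)) ?_
    · rintro s t hts ⟨i, hi, hs⟩
      exact ⟨i, hi, hlow _ hts hs⟩
    · rw [hI]
      exact ih _ (by omega)

/-- Chains in degree `n ≥ 0` never involve `∅`, so it does not matter whether `S` contains it. -/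
theorem PreAbstractSimplicialComplex.subsingleton_reducedHomology
    {D : PreAbstractSimplicialComplex X} {S : Set (Finset X)}
    (hS : ∀ s : Finset X, s.Nonempty → (s ∈ D.faces ↔ s ∈ S)) {n : ℕ}
    (h : SimplicialExactAt R S (n + 1)) : Subsingleton (D.ReducedHomology R n) := by
  have hset : ∀ m : ℕ, {s : Finset X | s.card = m + 1 ∧ (s = ∅ ∨ s ∈ D.faces)} =
      {s | s.card = m + 1 ∧ s ∈ S} := by
    intro m
    ext s
    refine and_congr_right fun hc => ?_
    have hne : s.Nonempty := Finset.card_pos.mp (by omega)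
    rw [← hS s hne]
    exact or_iff_right hne.ne_empty
  refine Submodule.Quotient.subsingleton_iff.mpr (eq_top_iff.mpr ?_)
  rintro ⟨z, hz, hz0⟩ _
  rw [augChains, hset] at hz
  obtain ⟨w, hw, hwz⟩ := h z hz hz0
  refine Submodule.mem_map.mpr ⟨w, ?_, hwz⟩
  rwa [augChains, hset]

end Exactness

/-! ### Finite weights and domination -/

namespace Network

variable {X : Type*}

theorem pathWeight_append (G : Network X) (x : X) (l l' : List X) :
    G.pathWeight x (l ++ l') =
      G.pathWeight x l + G.pathWeight ((x :: l).getLast (List.cons_ne_nil x l)) l' := by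
  induction l generalizing x with
  | nil => simp [pathWeight]
  | cons y l ih => simp [pathWeight, ih, add_assoc]

theorem pathCompletion_weight_lt_top_iff (G : Network X) {x y : X} :
    G.pathCompletion.weight x y < ∞ ↔
      ∃ l : List X, (x :: l).getLast (List.cons_ne_nil x l) = y ∧ G.pathWeight x l < ∞ := by
  simp [pathCompletion, iInf_lt_iff]

theorem pathCompletion_weight_le (G : Network X) (x y : X) :
    G.pathCompletion.weight x y ≤ G.weight x y :=
  (iInf₂_le (f := fun (l : List X) (_ : (x :: l).getLast (List.cons_ne_nil x l) = y) =>
    G.pathWeight x l) [y] rfl).trans (add_zero _).le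

/-- Two paths of finite weight concatenate to one of finite weight. -/
theorem pathCompletion_weight_lt_top_trans (G : Network X) (x y z : X)
    (hxy : G.pathCompletion.weight x y < ∞) (hyz : G.pathCompletion.weight y z < ∞) :
    G.pathCompletion.weight x z < ∞ := by
  rw [pathCompletion_weight_lt_top_iff] at *
  obtain ⟨l, rfl, hl⟩ := hxy
  obtain ⟨l', rfl, hl'⟩ := hyz
  refine ⟨l ++ l', ?_, ?_⟩
  · rcases l' with _ | ⟨a, l'⟩
    · simp
    · simp [List.getLast_cons]
  · rw [pathWeight_append]
    exact ENNReal.add_lt_top.mpr ⟨hl, hl'⟩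

theorem IsSourceDominating.pathCompletion {G : Network X} {K : Finset X}
    (h : G.IsSourceDominating K) : G.pathCompletion.IsSourceDominating K := fun x =>
  let ⟨v, hv, hvx⟩ := h x
  ⟨v, hv, (G.pathCompletion_weight_le v x).trans_lt hvx⟩

/-- The simplices of the maximal complex are the nonempty sets with a common source at finite
distance. -/
theorem mem_faces_of_isMaximalComplex {G : Network X} {D : PreAbstractSimplicialComplex X}
    (hD : IsMaximalComplex G.dowkerStar D) {s : Finset X} :
    s ∈ D.faces ↔ s.Nonempty ∧ ∃ y, ∀ x ∈ s, G.weight y x < ∞ := by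
  obtain ⟨δ, -, rfl, hδ⟩ := hD
  constructor
  · rintro ⟨hs, y, hy⟩
    exact ⟨hs, y, fun x hx => (hy x hx).trans_lt ENNReal.coe_lt_top⟩
  · rintro ⟨hs, y, hy⟩
    -- A scale past `δ`, where the filtration is constant, that also bounds every weight from `y`
    -- into `s`; the `1` makes the inequality strict.
    have hlt : δ < δ + 1 + ∑ x ∈ s, (G.weight y x).toNNReal :=
      (lt_add_one δ).trans_le le_self_add
    rw [← hδ _ hlt]
    refine ⟨hs, y, fun x hx => ?_⟩
    rw [rel, ← ENNReal.coe_toNNReal (hy x hx).ne, ENNReal.coe_le_coe]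
    exact (Finset.single_le_sum (f := fun x => (G.weight y x).toNNReal) (fun _ _ => zero_le)
      hx).trans le_add_self

/-- If the finite weights are transitive, the maximal complex is a union of full simplices indexed
by any source dominating set, hence it has no reduced homology in degrees `≥ |K| - 1`. -/
theorem subsingleton_reducedHomology_of_isSourceDominating [Finite X] [LinearOrder X]
    (R : Type*) [CommRing R] {G : Network X} {K : Finset X} (hK : G.IsSourceDominating K)
    (htrans : ∀ x y z : X, G.weight x y < ∞ → G.weight y z < ∞ → G.weight x z < ∞)
    {D : PreAbstractSimplicialComplex X} (hD : IsMaximalComplex G.dowkerStar D) {n : ℕ}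
    (hn : K.card ≤ n + 1) : Subsingleton (D.ReducedHomology R n) := by
  refine PreAbstractSimplicialComplex.subsingleton_reducedHomology (fun s hs => ?_)
    (simplicialExactAt_iUnion_simplex K (fun v => {x | G.weight v x < ∞}) hn)
  rw [mem_faces_of_isMaximalComplex hD]
  constructor
  · rintro ⟨-, y, hy⟩
    obtain ⟨v, hv, hvy⟩ := hK y
    exact ⟨v, hv, fun x hx => htrans v y x hvy (hy x hx)⟩
  · rintro ⟨v, -, hv⟩
    exact ⟨hs, v, fun x hx => hv hx⟩

end Network

theorem mainTheorem10 {X : Type*} [Finite X] [LinearOrder X] (R : Type*) [CommRing R]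
    (G : Network X) (K : Finset X) (k : ℕ) (hk : 1 ≤ k) (hK : K.card ≤ k) :
    (G.IsMinimalSourceDominating K ∨ G.pathCompletion.IsMinimalSourceDominating K →
      ∀ D, IsMaximalComplex G.dowker D →
        ∀ n : ℕ, k - 1 ≤ n → Subsingleton (D.ReducedHomology R n)) ∧
    (G.IsMinimalSourceDominating K →
      (∀ x y z : X, G.weight x y < ∞ → G.weight y z < ∞ → G.weight x z < ∞) →
      ∀ D, IsMaximalComplex G.dowkerStar D →
        ∀ n : ℕ, k - 1 ≤ n → Subsingleton (D.ReducedHomology R n)) := by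
  constructor
  · intro h D hD n hn
    -- `G.dowker` is by definition the `dowkerStar` filtration of `G.pathCompletion`, so `hD`
    -- applies as is.
    refine Network.subsingleton_reducedHomology_of_isSourceDominating R (G := G.pathCompletion)
      ?_ G.pathCompletion_weight_lt_top_trans hD (by omega : K.card ≤ n + 1)
    exact h.elim (fun h => h.1.pathCompletion) fun h => h.1
  · intro h htrans D hD n hn
    exact Network.subsingleton_reducedHomology_of_isSourceDominating R h.1 htrans hD (by omega)
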